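/- Let $M$ be a matroid on a set $E$ (finite or infinite), and let $\mathcal{A}=(A_1,\ldots,A_r)$ be any presentation of $M$: a finite sequence of subsets of $E$, repetitions and empty sets being allowed, such that the independent sets of $M$ are exactly the partial transversals of $\mathcal{A}$, i.e. the sets $I\subseteq E$ for which there is an injection $\phi:I\to\{1,\ldots,r\}$ with $x\in A_{\phi(x)}$ for all $x\in I$. (Thus $M$ is a transversal matroid, and $r$ may exceed the rank of $M$.) Call $M$ fundamental if it has some presentation $(A'_1,\ldots,A'_s)$ in which no difference $A'_i-\bigcup_{j\neq i}A'_j$ is empty. Let $\mathcal{Z}(M)$ be the set of cyclic flats of $M$, i.e. of flats that are (possibly empty) unions of circuits, ordered by inclusion; for $X\subseteq E$ let $\Delta(X)=\{k : X\cap A_k\neq\emptyset\}$; and let $r_M$ be the rank function of $M$. For a nonempty set $\mathcal{F}\subseteq\mathcal{Z}(M)$ consider the equality $$r_M\Bigl(\bigcap_{F\in\mathcal{F}}F\Bigr)=\Bigl|\bigcap_{F\in\mathcal{F}}\Delta(F)\Bigr|.\qquad(*)$$ Then the following are equivalent: 1. $M$ is fundamental; 2. $(*)$ holds for every nonempty subset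 $\mathcal{F}$ of $\mathcal{Z}(M)$; 3. $(*)$ holds for every nonempty filter (up-closed subset) $\mathcal{F}$ of $\mathcal{Z}(M)$; 4. $(*)$ holds for every nonempty antichain $\mathcal{F}$ in $\mathcal{Z}(M)$. -/

import Mathlib

open Set

/-- `I` is a partial transversal of the finite set system `A = (A₁, …, Aᵣ)` if there is an
injection `φ : I → [r]` with `x ∈ A (φ x)` for all `x ∈ I`. -/
def IsPartialTransversal {α : Type*} {r : ℕ} (A : Fin r → Set α) (I : Set α) : Prop :=
  ∃ φ : I → Fin r, Function.Injective φ ∧ ∀ x : I, (x : α) ∈ A (φ x)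

/-- The set system `A` on the ground set of `M` is a presentation of `M` if the independent sets
of `M` are exactly the partial transversals of `A`. Repeated sets and empty sets are allowed
in `A`, and `r` need not be the rank of `M`. -/
structure IsPresentation {α : Type*} {r : ℕ} (M : Matroid α) (A : Fin r → Set α) : Prop where
  subset_ground : ∀ i, A i ⊆ M.E
  indep_iff : ∀ I : Set α, M.Indep I ↔ IsPartialTransversal A I

/-- A fundamental transversal matroid: it has a presentation in which no set is contained in the
union of the others. -/
def IsFundamentalTransversal {α : Type*} (M : Matroid α) : Prop :=
  ∃ (r : ℕ) (A : Fin r → Set α), IsPresentation M A ∧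
    ∀ i, (A i \ ⋃ j ∈ {j | j ≠ i}, A j).Nonempty

/-- The collection `𝒵(M)` of cyclic flats of `M`: the flats that are (possibly empty) unions
of circuits. -/
def cyclicFlats {α : Type*} (M : Matroid α) : Set (Set α) :=
  {F | M.IsFlat F ∧ ∃ 𝒞 : Set (Set α), (∀ C ∈ 𝒞, M.IsCircuit C) ∧ F = ⋃₀ 𝒞}

/-- `Δ(X)`: the indices of the sets of the set system `A` that meet `X`. -/
def indexSupport {α : Type*} {r : ℕ} (A : Fin r → Set α) (X : Set α) : Set (Fin r) :=
  {k | (X ∩ A k).Nonempty}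

/-- `𝓕` is a filter in the collection `𝒵` of sets, ordered by inclusion. -/
def IsFilterIn {α : Type*} (𝒵 𝓕 : Set (Set α)) : Prop :=
  𝓕 ⊆ 𝒵 ∧ ∀ F ∈ 𝓕, ∀ G ∈ 𝒵, F ⊆ G → G ∈ 𝓕

/-! In any presentation, circuits, hence cyclic flats and their unions, have rank $|\Delta|$. By
inclusion-exclusion $|\bigcap\Delta(F)|$ is then the same for all presentations, so 1 → 2 may use
one with private elements: the private element of $A_k$ lies in every cyclic flat $F$ with
$k\in\Delta(F)$, which gives the nontrivial inequality. For 4 → 3, pass to the minimal members of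
the filter. For 3 → 1, the filters $\{F : k\in\Delta(F)\}$ yield an independent set with
$|\Delta(F)|$ elements in each $F$ (`exists_isBase_forall_eRk_le`). Extend it to a base $B$; the
cocircuits $E-\mathrm{cl}(B-e)$ present $M$, each with $e$ private
(`isFundamentalTransversal_of_isBase`). -/

open Matroid

/-! ### Index supports and Hall's theorem -/

section SetSystem

variable {α : Type*} {r : ℕ} {A : Fin r → Set α} {X Y I : Set α}

lemma mem_indexSupport {k : Fin r} : k ∈ indexSupport A X ↔ ∃ x ∈ X, x ∈ A k := Iff.rfl

lemma indexSupport_mono (h : X ⊆ Y) : indexSupport A X ⊆ indexSupport A Y :=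
  fun _ ⟨x, hx, hk⟩ ↦ ⟨x, h hx, hk⟩

lemma indexSupport_union : indexSupport A (X ∪ Y) = indexSupport A X ∪ indexSupport A Y := by
  ext k
  simp [indexSupport, union_inter_distrib_right]

lemma indexSupport_biUnion {ι : Type*} (t : Set ι) (X : ι → Set α) :
    indexSupport A (⋃ i ∈ t, X i) = ⋃ i ∈ t, indexSupport A (X i) := by
  ext k
  simp only [mem_indexSupport, mem_iUnion]
  grind

lemma indexSupport_sInter_subset (𝓕 : Set (Set α)) :
    indexSupport A (⋂₀ 𝓕) ⊆ ⋂ F ∈ 𝓕, indexSupport A F :=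
  subset_iInter₂ fun _ hF ↦ indexSupport_mono (sInter_subset_of_mem hF)

lemma IsPartialTransversal.encard_le (h : IsPartialTransversal A I) :
    I.encard ≤ (indexSupport A I).encard := by
  obtain ⟨φ, hφ, hA⟩ := h
  exact Function.Embedding.encard_le
    ⟨fun x : I ↦ ⟨φ x, x, x.2, hA x⟩, fun x y hxy ↦ hφ (congrArg Subtype.val hxy)⟩

lemma IsPartialTransversal.image {J : Set (Fin r)} {g : Fin r → α}
    (hgA : ∀ k ∈ J, g k ∈ A k) : IsPartialTransversal A (g '' J) := by
  choose f hfJ hf using fun x : g '' J ↦ x.2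
  refine ⟨f, fun x y hxy ↦ Subtype.ext ?_, fun x ↦ ?_⟩
  · rw [← hf x, ← hf y, hxy]
  · exact (hf x) ▸ hgA _ (hfJ x)

/-- Hall's marriage theorem for partial transversals. -/
lemma isPartialTransversal_of_forall_encard_le
    (h : ∀ S ⊆ I, S.Finite → S.encard ≤ (indexSupport A S).encard) :
    IsPartialTransversal A I := by
  classical
  obtain ⟨φ, hφ, hφA⟩ := (Finset.all_card_le_biUnion_card_iff_exists_injective
    (fun x : I ↦ Finset.univ.filter fun k ↦ (x : α) ∈ A k)).1 fun s ↦ by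
      have hs := h (Subtype.val '' (s : Set I)) (by simp) (s.finite_toSet.image _)
      rw [Subtype.val_injective.encard_image, encard_coe_eq_coe_finsetCard] at hs
      have heq : indexSupport A (Subtype.val '' (s : Set I)) =
          ((s.biUnion fun x : I ↦ Finset.univ.filter fun k ↦ (x : α) ∈ A k : Finset (Fin r)) :
            Set (Fin r)) := by
        ext k
        simp [mem_indexSupport]
      rw [heq, encard_coe_eq_coe_finsetCard] at hs
      exact_mod_cast hs
  exact ⟨φ, hφ, fun x ↦ by simpa using hφA x⟩

end SetSystem

/-! ### Sizes of intersections from sizes of unions -/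

section InclusionExclusion

variable {ι κ κ' : Type*} [Finite κ] [Finite κ']

lemma ncard_biInter_eq_neg_sum_powerset {s : Finset ι} (hs : s.Nonempty) (a : ι → Set κ) :
    ((⋂ i ∈ s, a i).ncard : ℤ) =
      -∑ t ∈ s.powerset, (-1 : ℤ) ^ t.card * (⋃ i ∈ t, a i).ncard := by
  classical
  have := Fintype.ofFinite κ
  have hie := Finset.inclusion_exclusion_card_inf_compl s (fun i ↦ ((a i)ᶜ).toFinset)
  have hl : ((s.inf fun i ↦ (((a i)ᶜ).toFinset)ᶜ : Finset κ) : Set κ) = ⋂ i ∈ s, a i := by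
    ext k
    simp [Finset.mem_inf]
  have hr (t : Finset ι) : ((t.inf fun i ↦ ((a i)ᶜ).toFinset).card : ℤ) =
      Fintype.card κ - (⋃ i ∈ t, a i).ncard := by
    have hc : ((t.inf fun i ↦ ((a i)ᶜ).toFinset : Finset κ) : Set κ) = (⋃ i ∈ t, a i)ᶜ := by
      ext k
      simp [Finset.mem_inf]
    rw [← ncard_coe_finset, hc, ← Nat.card_eq_fintype_card, ← ncard_add_ncard_compl (⋃ i ∈ t, a i)]
    push_cast
    ring
  -- The constant terms `Fintype.card κ` cancel because the alternating sum over subsets of a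
  -- nonempty set is zero.
  rw [← hl, ncard_coe_finset, hie]
  simp_rw [hr, mul_sub, Finset.sum_sub_distrib, ← Finset.sum_mul,
    Finset.sum_powerset_neg_one_pow_card_of_nonempty hs]
  simp

lemma encard_biInter_eq_of_encard_biUnion_eq {s : Finset ι} (hs : s.Nonempty) {a : ι → Set κ}
    {b : ι → Set κ'} (h : ∀ t ⊆ s, (⋃ i ∈ t, a i).encard = (⋃ i ∈ t, b i).encard) :
    (⋂ i ∈ s, a i).encard = (⋂ i ∈ s, b i).encard := by
  rw [← (toFinite _).cast_ncard_eq, ← (toFinite _).cast_ncard_eq, Nat.cast_inj, ← Int.natCast_inj,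
    ncard_biInter_eq_neg_sum_powerset hs, ncard_biInter_eq_neg_sum_powerset hs]
  refine congrArg _ (Finset.sum_congr rfl fun t ht ↦ ?_)
  rw [ncard_def, ncard_def, h t (Finset.mem_powerset.1 ht)]

end InclusionExclusion

/-! ### Sets whose rank equals the size of their index support -/

namespace IsPresentation

variable {α : Type*} {M : Matroid α} {r : ℕ} {A : Fin r → Set α} {X Y F G I C : Set α}
  {𝒢 𝓕 : Set (Set α)}

lemma encard_le (hA : IsPresentation M A) (hI : M.Indep I) :
    I.encard ≤ (indexSupport A I).encard :=
  ((hA.indep_iff I).1 hI).encard_le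

lemma eRk_le (hA : IsPresentation M A) (X : Set α) : M.eRk X ≤ (indexSupport A X).encard :=
  eRk_le_iff.2 fun _ hIX hI ↦ (hA.encard_le hI).trans (encard_le_encard (indexSupport_mono hIX))

lemma rankFinite (hA : IsPresentation M A) : M.RankFinite := by
  rw [← eRank_lt_top_iff, eRank_def]
  exact (hA.eRk_le _).trans_lt (toFinite _).encard_lt_top

/-- A set whose rank is the size of its index support contains a matching of that support. -/
lemma exists_matching [Nonempty α] (hA : IsPresentation M A)
    (hX : M.eRk X = (indexSupport A X).encard) :
    ∃ g : Fin r → α, InjOn g (indexSupport A X) ∧ ∀ k ∈ indexSupport A X, g k ∈ X ∩ A k := by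
  obtain ⟨I, hI⟩ := M.exists_isBasis' X
  obtain ⟨φ, hφ, hφA⟩ := (hA.indep_iff I).1 hI.indep
  have hrange : range φ = indexSupport A X := by
    refine (toFinite _).eq_of_subset_of_encard_le ?_ ?_
    · rintro _ ⟨x, rfl⟩
      exact ⟨x, hI.subset x.2, hφA x⟩
    · rw [← hX, hI.eRk_eq_encard, ← image_univ, hφ.encard_image, encard_univ]
      rfl
  have hex (k : Fin r) : ∃ y : α, k ∈ indexSupport A X → ∃ x : I, φ x = k ∧ (x : α) = y := by
    by_cases hk : k ∈ indexSupport A X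
    · obtain ⟨x, rfl⟩ := hrange.symm ▸ hk
      exact ⟨x, fun _ ↦ ⟨x, rfl, rfl⟩⟩
    · exact ⟨Classical.arbitrary α, fun h ↦ absurd h hk⟩
  choose g hg using hex
  refine ⟨g, fun k hk l hl hkl ↦ ?_, fun k hk ↦ ?_⟩
  · obtain ⟨x, rfl, hx⟩ := hg k hk
    obtain ⟨y, rfl, hy⟩ := hg l hl
    rw [Subtype.ext (hx.trans (hkl.trans hy.symm))]
  · obtain ⟨x, rfl, hx⟩ := hg k hk
    rw [← hx]
    exact ⟨hI.subset x.2, hφA x⟩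

lemma eRk_eq_of_matching (hA : IsPresentation M A) {g : Fin r → α}
    (hg : InjOn g (indexSupport A X)) (hgX : ∀ k ∈ indexSupport A X, g k ∈ X ∩ A k) :
    M.eRk X = (indexSupport A X).encard := by
  refine (hA.eRk_le X).antisymm ?_
  have hI : M.Indep (g '' indexSupport A X) :=
    (hA.indep_iff _).2 (.image fun k hk ↦ (hgX k hk).2)
  rw [← hg.encard_image]
  exact hI.encard_le_eRk_of_subset (image_subset_iff.2 fun k hk ↦ (hgX k hk).1)

/-- Keep a matching for $X$ and use one for $Y$ on the remaining indices. They cannot collide: an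
element of $X$ lies only in sets indexed by $\Delta(X)$. -/
lemma eRk_union_eq (hA : IsPresentation M A) (hX : M.eRk X = (indexSupport A X).encard)
    (hY : M.eRk Y = (indexSupport A Y).encard) :
    M.eRk (X ∪ Y) = (indexSupport A (X ∪ Y)).encard := by
  classical
  obtain hα | hα := isEmpty_or_nonempty α
  · rw [← hX.trans (congrArg _ (congrArg _ (Subsingleton.elim X (X ∪ Y))))]
    exact congrArg _ (Subsingleton.elim _ _)
  obtain ⟨g, hg, hgX⟩ := hA.exists_matching hX
  obtain ⟨h, hh, hhY⟩ := hA.exists_matching hY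
  refine hA.eRk_eq_of_matching (g := fun k ↦ if k ∈ indexSupport A X then g k else h k) ?_ ?_
  · intro k hk l hl hkl
    rw [indexSupport_union] at hk hl
    by_cases hkX : k ∈ indexSupport A X <;> by_cases hlX : l ∈ indexSupport A X <;>
      simp only [hkX, hlX, if_true, if_false] at hkl
    · exact hg hkX hlX hkl
    · exact absurd ⟨h l, hkl ▸ (hgX k hkX).1, (hhY l (hl.resolve_left hlX)).2⟩ hlX
    · exact absurd ⟨h k, hkl ▸ (hgX l hlX).1, (hhY k (hk.resolve_left hkX)).2⟩ hkX
    · exact hh (hk.resolve_left hkX) (hl.resolve_left hlX) hkl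
  · intro k hk
    rw [indexSupport_union] at hk
    by_cases hkX : k ∈ indexSupport A X <;> simp only [hkX, if_true, if_false]
    · exact ⟨.inl (hgX k hkX).1, (hgX k hkX).2⟩
    · have := hhY k (hk.resolve_left hkX)
      exact ⟨.inr this.1, this.2⟩

lemma eRk_biUnion_eq (hA : IsPresentation M A) {ι : Type*} (t : Finset ι) {X : ι → Set α}
    (hX : ∀ i ∈ t, M.eRk (X i) = (indexSupport A (X i)).encard) :
    M.eRk (⋃ i ∈ t, X i) = (indexSupport A (⋃ i ∈ t, X i)).encard := by
  classical
  induction t using Finset.induction_on with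
  | empty => simp [indexSupport]
  | insert a s _ ih =>
    rw [Finset.set_biUnion_insert]
    exact hA.eRk_union_eq (hX a (by simp)) (ih fun i hi ↦ hX i (by simp [hi]))

/-- Even if `𝒢` is infinite, one member per index of the finite support suffices. -/
lemma eRk_sUnion_eq (hA : IsPresentation M A)
    (h𝒢 : ∀ G ∈ 𝒢, M.eRk G = (indexSupport A G).encard) :
    M.eRk (⋃₀ 𝒢) = (indexSupport A (⋃₀ 𝒢)).encard := by
  classical
  have hex (k : indexSupport A (⋃₀ 𝒢)) : ∃ G ∈ 𝒢, (k : Fin r) ∈ indexSupport A G := by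
    obtain ⟨x, ⟨G, hG, hxG⟩, hx⟩ := k.2
    exact ⟨G, hG, x, hxG, hx⟩
  choose G hG𝒢 hG using hex
  have := Fintype.ofFinite (indexSupport A (⋃₀ 𝒢))
  have h := hA.eRk_biUnion_eq Finset.univ (X := G) fun k _ ↦ h𝒢 _ (hG𝒢 k)
  refine (hA.eRk_le _).antisymm (le_trans (encard_le_encard fun k hk ↦ ?_) (h.symm.le.trans
    (M.eRk_mono (iUnion₂_subset fun k _ ↦ subset_sUnion_of_mem (hG𝒢 k)))))
  exact indexSupport_mono (subset_biUnion_of_mem (u := G) (Finset.mem_univ ⟨k, hk⟩)) (hG ⟨k, hk⟩)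

/-- Proper subsets of $C$ are independent, so satisfy Hall's condition. As $|C|=r(C)+1$, a strict
inequality $r(C)<|\Delta(C)|$ would give it for $C$ too. -/
lemma eRk_isCircuit_eq (hA : IsPresentation M A) (hC : M.IsCircuit C) :
    M.eRk C = (indexSupport A C).encard := by
  refine (hA.eRk_le C).antisymm (not_lt.1 fun hlt ↦ hC.not_indep ?_)
  refine (hA.indep_iff C).2 (isPartialTransversal_of_forall_encard_le fun S hSC _ ↦ ?_)
  obtain rfl | hne := eq_or_ne S C
  · rw [← hC.eRk_add_one_eq]
    exact Order.add_one_le_of_lt hlt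
  · exact hA.encard_le (hC.ssubset_indep (hSC.ssubset_of_ne hne))

lemma eRk_cyclicFlat_eq (hA : IsPresentation M A) (hF : F ∈ cyclicFlats M) :
    M.eRk F = (indexSupport A F).encard := by
  obtain ⟨-, 𝒞, h𝒞, rfl⟩ := hF
  exact hA.eRk_sUnion_eq fun C hC ↦ hA.eRk_isCircuit_eq (h𝒞 C hC)

/-- Adding $X$ to $F$ leaves the support, hence the rank, unchanged, and $F$ is a flat. -/
lemma subset_cyclicFlat (hA : IsPresentation M A) (hF : F ∈ cyclicFlats M) (hX : X ⊆ M.E)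
    (h : indexSupport A X ⊆ indexSupport A F) : X ⊆ F := by
  have := hA.rankFinite
  have hcl := (M.isRkFinite_set F).closure_eq_closure_of_subset_of_eRk_ge_eRk
    (subset_union_left (t := X)) (by
      rw [hA.eRk_cyclicFlat_eq hF]
      refine (hA.eRk_le _).trans (encard_le_encard ?_)
      rw [indexSupport_union, union_eq_self_of_subset_right h])
  rw [hF.1.closure] at hcl
  rw [hcl]
  exact subset_union_right.trans
    (M.subset_closure _ (union_subset hF.1.subset_ground hX))

lemma finite_cyclicFlats (hA : IsPresentation M A) : (cyclicFlats M).Finite :=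
  Finite.of_injOn (f := indexSupport A) (mapsTo_univ _ _)
    (fun _ hF _ hG h ↦ (hA.subset_cyclicFlat hG hF.1.subset_ground h.subset).antisymm
      (hA.subset_cyclicFlat hF hG.1.subset_ground h.symm.subset)) finite_univ

/-- The size of the intersection of the index supports of cyclic flats does not depend on the
presentation. -/
lemma encard_biInter_indexSupport_eq (hA : IsPresentation M A) {s : ℕ} {A' : Fin s → Set α}
    (hA' : IsPresentation M A') (h𝓕 : 𝓕 ⊆ cyclicFlats M) (hne : 𝓕.Nonempty) :
    (⋂ F ∈ 𝓕, indexSupport A F).encard = (⋂ F ∈ 𝓕, indexSupport A' F).encard := by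
  obtain ⟨s, rfl⟩ := (hA.finite_cyclicFlats.subset h𝓕).exists_finset_coe
  refine encard_biInter_eq_of_encard_biUnion_eq (by simpa using hne) fun t ht ↦ ?_
  have h1 := hA.eRk_biUnion_eq t (X := id) fun F hF ↦ hA.eRk_cyclicFlat_eq (h𝓕 (ht hF))
  have h2 := hA'.eRk_biUnion_eq t (X := id) fun F hF ↦ hA'.eRk_cyclicFlat_eq (h𝓕 (ht hF))
  rw [h1] at h2
  simpa only [← Finset.mem_coe, indexSupport_biUnion, id] using h2

lemma eRk_sInter_eq_of_private (hA : IsPresentation M A)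
    (hpriv : ∀ i, (A i \ ⋃ j ∈ {j | j ≠ i}, A j).Nonempty) (h𝓕 : 𝓕 ⊆ cyclicFlats M) :
    M.eRk (⋂₀ 𝓕) = (⋂ F ∈ 𝓕, indexSupport A F).encard := by
  refine ((hA.eRk_le _).trans (encard_le_encard (indexSupport_sInter_subset 𝓕))).antisymm ?_
  choose b hbA hb using hpriv
  have hb' {i j : Fin r} (h : b i ∈ A j) : j = i := by
    by_contra hne
    exact hb i (mem_iUnion₂.2 ⟨j, hne, h⟩)
  have hinj : Function.Injective b := fun i j hij ↦ hb' (hij ▸ hbA i : b j ∈ A i)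
  rw [← hinj.encard_image]
  refine Indep.encard_le_eRk_of_subset
    ((hA.indep_iff _).2 (.image fun k _ ↦ hbA k)) ?_
  rintro _ ⟨k, hk, rfl⟩ F hF
  refine singleton_subset_iff.1 (hA.subset_cyclicFlat (h𝓕 hF)
    (singleton_subset_iff.2 (hA.subset_ground k (hbA k))) ?_)
  rintro j ⟨_, rfl, hj⟩
  rw [hb' hj]
  exact mem_iInter₂.1 hk F hF

/-- If the rank equality holds for filters of cyclic flats, then some base spans every cyclic
flat by its intersection with it. -/
lemma exists_isBase_forall_eRk_le (hA : IsPresentation M A)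
    (h : ∀ 𝓕 : Set (Set α), 𝓕.Nonempty → IsFilterIn (cyclicFlats M) 𝓕 →
      M.eRk (⋂₀ 𝓕) = (⋂ F ∈ 𝓕, indexSupport A F).encard) :
    ∃ B, M.IsBase B ∧ ∀ F ∈ cyclicFlats M, M.eRk F ≤ (B ∩ F).encard := by
  obtain hα | hα := isEmpty_or_nonempty α
  · obtain ⟨B, hB⟩ := M.exists_isBase
    refine ⟨B, hB, fun F _ ↦ (M.eRk_le_encard F).trans_eq ?_⟩
    exact congrArg _ (Subsingleton.elim _ _)
  let S (k : Fin r) : Set (Set α) := {F ∈ cyclicFlats M | k ∈ indexSupport A F}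
  let U : Set (Fin r) := {k | (S k).Nonempty}
  have hS (k : Fin r) : IsFilterIn (cyclicFlats M) (S k) :=
    ⟨fun F hF ↦ hF.1, fun F hF G hG hFG ↦ ⟨hG, indexSupport_mono hFG hF.2⟩⟩
  -- Rank is at most $|\Delta(\bigcap F)|$, which is at most $|\bigcap\Delta(F)|$; the hypothesis
  -- forces equality throughout.
  have hD (k : Fin r) (hk : k ∈ U) :
      indexSupport A (⋂₀ S k) = ⋂ F ∈ S k, indexSupport A F :=
    (toFinite _).eq_of_subset_of_encard_le (indexSupport_sInter_subset _)
      ((h _ hk (hS k)).symm.le.trans (hA.eRk_le _))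
  have htight (k : Fin r) (hk : k ∈ U) :
      M.eRk (⋂₀ S k) = (indexSupport A (⋂₀ S k)).encard := by
    rw [hD k hk, h _ hk (hS k)]
  have hself (k : Fin r) (hk : k ∈ U) : k ∈ indexSupport A (⋂₀ S k) := by
    rw [hD k hk]
    exact mem_iInter₂.2 fun F hF ↦ hF.2
  have hsub {k l : Fin r} (hk : k ∈ U) (hl : l ∈ indexSupport A (⋂₀ S k)) : S k ⊆ S l := by
    rw [hD k hk] at hl
    exact fun F hF ↦ ⟨hF.1, mem_iInter₂.1 hl F hF⟩
  -- The matching depends on the set alone, so indices with equal `S k` share one; `hbinj` relies on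
  -- this.
  have hex (X : Set α) : ∃ g : Fin r → α, M.eRk X = (indexSupport A X).encard →
      InjOn g (indexSupport A X) ∧ ∀ k ∈ indexSupport A X, g k ∈ X ∩ A k := by
    by_cases hX : M.eRk X = (indexSupport A X).encard
    · obtain ⟨g, hg⟩ := hA.exists_matching hX
      exact ⟨g, fun _ ↦ hg⟩
    · exact ⟨fun _ ↦ Classical.arbitrary α, fun h ↦ absurd h hX⟩
  choose g hg using hex
  let b (k : Fin r) : α := g (⋂₀ S k) k
  have hbmem (k : Fin r) (hk : k ∈ U) : b k ∈ ⋂₀ S k ∩ A k :=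
    (hg _ (htight k hk)).2 k (hself k hk)
  have hbinj : InjOn b U := by
    intro k hk l hl hkl
    have hSkl : S k = S l := by
      refine (hsub hk ?_).antisymm (hsub hl ?_)
      · exact ⟨b l, hkl ▸ (hbmem k hk).1, (hbmem l hl).2⟩
      · exact ⟨b k, hkl ▸ (hbmem l hl).1, (hbmem k hk).2⟩
    have hl' := hself l hl
    rw [← hSkl] at hl'
    refine (hg _ (htight k hk)).1 (hself k hk) hl' ?_
    simpa only [b, hSkl] using hkl
  have hI : M.Indep (b '' U) := (hA.indep_iff _).2 (.image fun k hk ↦ (hbmem k hk).2)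
  obtain ⟨B, hB, hIB⟩ := hI.exists_isBase_superset
  refine ⟨B, hB, fun F hF ↦ ?_⟩
  have hFU : indexSupport A F ⊆ U := fun k hk ↦ ⟨F, hF, hk⟩
  rw [hA.eRk_cyclicFlat_eq hF, ← (hbinj.mono hFU).encard_image]
  refine encard_le_encard ?_
  rintro _ ⟨k, hk, rfl⟩
  exact ⟨hIB ⟨k, hFU hk, rfl⟩, (hbmem k (hFU hk)).1 F ⟨hF, hk⟩⟩

end IsPresentation

/-! ### From a base to a fundamental presentation -/

lemma closure_isCircuit_mem_cyclicFlats {α : Type*} {M : Matroid α} {C : Set α}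
    (hC : M.IsCircuit C) : M.closure C ∈ cyclicFlats M := by
  refine ⟨M.isFlat_closure C, {C' | M.IsCircuit C' ∧ C' ⊆ M.closure C}, fun _ h ↦ h.1, ?_⟩
  refine subset_antisymm (fun e he ↦ ?_) (sUnion_subset fun _ h ↦ h.2)
  by_cases heC : e ∈ C
  · exact ⟨C, ⟨hC, M.subset_closure C hC.subset_ground⟩, heC⟩
  · obtain ⟨C', hC'sub, hC', heC'⟩ := exists_isCircuit_of_mem_closure he heC
    exact ⟨C', ⟨hC', hC'sub.trans
      (insert_subset he (M.subset_closure C hC.subset_ground))⟩, heC'⟩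

/-- If a finite base meets every cyclic flat in a spanning set, then its fundamental cocircuits
form a presentation in which every set has a private element. -/
lemma isFundamentalTransversal_of_isBase {α : Type*} {M : Matroid α} [M.RankFinite] {B : Set α}
    (hB : M.IsBase B) (h : ∀ F ∈ cyclicFlats M, M.eRk F ≤ (B ∩ F).encard) :
    IsFundamentalTransversal M := by
  obtain ⟨n, e, he, rfl⟩ := hB.finite.fin_param
  let A (i : Fin n) : Set α := M.E \ M.closure (range e \ {e i})
  have hmem (i j : Fin n) : e i ∈ A j ↔ i = j := by
    constructor
    · intro hij
      by_contra hne
      exact hij.2 (M.mem_closure_of_mem' ⟨mem_range_self i, fun h' ↦ hne (he h')⟩ hij.1)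
    · rintro rfl
      exact ⟨hB.subset_ground (mem_range_self i),
        hB.indep.notMem_closure_sdiff_of_mem (mem_range_self i)⟩
  refine ⟨n, A, ⟨fun i ↦ sdiff_subset, fun I ↦ ⟨fun hI ↦ ?_, fun hI ↦ ?_⟩⟩, fun i ↦ ?_⟩
  · refine isPartialTransversal_of_forall_encard_le fun S hSI _ ↦ ?_
    have hS := hI.subset hSI
    have hcl : S ⊆ M.closure (e '' indexSupport A S) := by
      -- If $i\notin\Delta(S)$ then $S\subseteq\mathrm{cl}(B-e_i)$, and closure commutes with
      -- intersecting subsets of $B$. Including $B$ itself covers the case where no such $i$ exists.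
      let Js := insert (range e) ((fun i ↦ range e \ {e i}) '' (indexSupport A S)ᶜ)
      have hJ := hB.indep.closure_sInter_eq_biInter_closure_of_forall_subset
        (Js := Js) (insert_nonempty _ _) (by
          rintro J (rfl | ⟨i, -, rfl⟩)
          · exact subset_rfl
          · exact sdiff_subset)
      refine subset_trans (fun x hx ↦ ?_) (M.closure_subset_closure (X := ⋂₀ Js) ?_)
      · rw [hJ]
        refine mem_iInter₂.2 ?_
        rintro J (rfl | ⟨i, hi, rfl⟩)
        · rw [hB.closure_eq]
          exact hS.subset_ground hx
        · by_contra hxi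
          exact hi ⟨x, hx, hS.subset_ground hx, hxi⟩
      · intro y hy
        obtain ⟨i, rfl⟩ := hy _ (mem_insert _ _)
        refine ⟨i, ?_, rfl⟩
        by_contra hi
        exact (hy _ (mem_insert_of_mem _ ⟨i, hi, rfl⟩)).2 rfl
    calc S.encard ≤ M.eRk (M.closure (e '' indexSupport A S)) := hS.encard_le_eRk_of_subset hcl
      _ ≤ (e '' indexSupport A S).encard := by
        rw [eRk_closure_eq]
        exact M.eRk_le_encard _
      _ = (indexSupport A S).encard := he.encard_image _
  · have hIE : I ⊆ M.E := by
      obtain ⟨φ, -, hφ⟩ := hI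
      exact fun x hx ↦ (hφ ⟨x, hx⟩).1
    by_contra hdep
    obtain ⟨C, hCI, hC⟩ := ((not_indep_iff hIE).1 hdep).exists_isCircuit_subset
    have hF := closure_isCircuit_mem_cyclicFlats hC
    set F := M.closure C with hFdef
    have hspan : F ⊆ M.closure (range e ∩ F) := by
      have := (M.isRkFinite_set (range e ∩ F)).closure_eq_closure_of_subset_of_eRk_ge_eRk
        (inter_subset_right (t := F)) (by
          rw [(hB.indep.subset inter_subset_left).eRk_eq_encard]
          exact h F hF)
      rw [this]
      exact M.subset_closure F hF.1.subset_ground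
    have hCF : C ⊆ F := M.subset_closure C hC.subset_ground
    -- If $e_i\notin F$, then $C\subseteq\mathrm{cl}(B\cap F)\subseteq\mathrm{cl}(B-e_i)$, so $C$
    -- misses $A_i$.
    have hsupp : e '' indexSupport A C ⊆ range e ∩ F := by
      rintro _ ⟨i, ⟨x, hxC, hx⟩, rfl⟩
      refine ⟨mem_range_self i, ?_⟩
      by_contra hi
      refine hx.2 (M.closure_subset_closure ?_ (hspan (hCF hxC)))
      exact fun y hy ↦ ⟨hy.1, fun hyi ↦ hi (hyi ▸ hy.2)⟩
    have hCtrans : IsPartialTransversal A C := by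
      obtain ⟨φ, hφ, hφA⟩ := hI
      exact ⟨fun x ↦ φ ⟨x, hCI x.2⟩,
        fun x y hxy ↦ Subtype.ext (Subtype.mk.inj (hφ hxy)), fun x ↦ hφA ⟨x, hCI x.2⟩⟩
    have hle : C.encard ≤ M.eRk C := calc
      C.encard ≤ (indexSupport A C).encard := hCtrans.encard_le
      _ = (e '' indexSupport A C).encard := (he.encard_image _).symm
      _ ≤ M.eRk F :=
        ((hB.indep.subset inter_subset_left).subset hsupp).encard_le_eRk_of_subset
          hsupp |>.trans (M.eRk_mono inter_subset_right)
      _ = M.eRk C := M.eRk_closure_eq C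
    exact hC.not_indep ((M.isRkFinite_set C).indep_of_encard_le_eRk hle)
  · refine ⟨e i, (hmem i i).2 rfl, fun hi ↦ ?_⟩
    obtain ⟨j, hj, hij⟩ := mem_iUnion₂.1 hi
    exact hj ((hmem i j).1 hij).symm

theorem corollary4p6 {α : Type*} (M : Matroid α) {r : ℕ} (A : Fin r → Set α)
    (hA : IsPresentation M A) :
    List.TFAE [
      IsFundamentalTransversal M,
      ∀ 𝓕 : Set (Set α), 𝓕.Nonempty → 𝓕 ⊆ cyclicFlats M →
        M.eRk (⋂₀ 𝓕) = (⋂ F ∈ 𝓕, indexSupport A F).encard,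
      ∀ 𝓕 : Set (Set α), 𝓕.Nonempty → IsFilterIn (cyclicFlats M) 𝓕 →
        M.eRk (⋂₀ 𝓕) = (⋂ F ∈ 𝓕, indexSupport A F).encard,
      ∀ 𝓕 : Set (Set α), 𝓕.Nonempty → 𝓕 ⊆ cyclicFlats M → IsAntichain (· ⊆ ·) 𝓕 →
        M.eRk (⋂₀ 𝓕) = (⋂ F ∈ 𝓕, indexSupport A F).encard] := by
  tfae_have 1 → 2 := by
    rintro ⟨s, A', hA', hpriv⟩ 𝓕 hne h𝓕
    rw [hA.encard_biInter_indexSupport_eq hA' h𝓕 hne]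
    exact hA'.eRk_sInter_eq_of_private hpriv h𝓕
  tfae_have 2 → 4 := fun h 𝓕 hne h𝓕 _ ↦ h 𝓕 hne h𝓕
  tfae_have 4 → 3 := by
    intro h 𝓕 hne h𝓕
    have hmin (F) (hF : F ∈ 𝓕) : ∃ G ⊆ F, Minimal (· ∈ 𝓕) G :=
      (hA.finite_cyclicFlats.subset h𝓕.1).exists_le_minimal hF
    have h4 := h {F | Minimal (· ∈ 𝓕) F}
      (let ⟨F, hF⟩ := hne; let ⟨G, _, hG⟩ := hmin F hF; ⟨G, hG⟩)
      (fun F hF ↦ h𝓕.1 hF.1) (setOfPred_minimal_antichain _)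
    have h1 : ⋂₀ {F | Minimal (· ∈ 𝓕) F} = ⋂₀ 𝓕 := by
      refine subset_antisymm (subset_sInter fun F hF ↦ ?_) (sInter_subset_sInter fun F hF ↦ hF.1)
      obtain ⟨G, hGF, hG⟩ := hmin F hF
      exact (sInter_subset_of_mem hG).trans hGF
    have h2 : ⋂ F ∈ {F | Minimal (· ∈ 𝓕) F}, indexSupport A F = ⋂ F ∈ 𝓕, indexSupport A F := by
      refine subset_antisymm (subset_iInter₂ fun F hF ↦ ?_)
        (biInter_subset_biInter_left fun F hF ↦ hF.1)
      obtain ⟨G, hGF, hG⟩ := hmin F hF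
      exact (iInter₂_subset G hG).trans (indexSupport_mono hGF)
    rwa [h1, h2] at h4
  tfae_have 3 → 1 := by
    intro h
    have := hA.rankFinite
    obtain ⟨B, hB, hBF⟩ := hA.exists_isBase_forall_eRk_le h
    exact isFundamentalTransversal_of_isBase hB hBF
  tfae_finish
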